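/- **Setting.** Let $\Omega\subset\mathbb R^N$ be a bounded domain (nonempty, open, connected) with $C^2$ boundary $\Sigma=\partial\Omega$. A *connected $m$-phase partitioning* of $\Omega$ is a family $M=(M_i)_{i=1}^{m-1}$ of nonempty, compact, pairwise disjoint $C^2$ hypersurfaces $M_i\subset\overline\Omega$ whose ($C^2$) boundary is $M_i\cap\Sigma$, where they meet $\Sigma$ transversally, such that $\Omega\setminus\bigcup_i M_i$ has exactly $m$ connected components (the phases) and each $M_i$ is the interface between two of the phases (one phase lies on one side of $M_i$, another one on the other side). Let $\gamma_i>0$ and $A(M)=\sum_i\gamma_i A(M_i)$, where $A(M_i)$ is the $(N-1)$-dimensional area. A *variation* of $M$ is a family $\xi^t$, $|t|<\delta$, of $C^2$ diffeomorphisms of $\mathbb R^N$, jointly $C^2$ in $(x,t)$, with $\xi^0=\mathrm{id}$, equal to the identity off a fixed compact set, and such that $\frac{d}{dt}\xi^t(x)=w(\xi^t(x))$ for all $x$ in a neighbourhood of $\bigcup_i M_i$, where $w=\partial_t\xi^t|_{t=0}$. It is *admissible* if $\xi^t(\Sigma)=\Sigma$ and $\xi^t$ preserves the volume of every phase for all $|t|<\delta$,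 and *normal* if $w(p)\perp T_pM_i$ for all $p\in M_i$ and all $i$. Write $M^t=\xi^t(M)$, $\delta A(M)=\frac{d}{dt}A(M^t)|_{t=0}$ and $\delta^2A(M)=\frac{d^2}{dt^2}A(M^t)|_{t=0}$; when $\delta^2A(M)$ is said to be positive or negative, it is understood that $t\mapsto A(\xi^t(M_i))$ is twice differentiable at $0$ for each $i$. The partitioning $M$ is *minimal* if $\delta A(M)=0$ for all admissible variations. A minimal $M$ is *stable* if $\delta^2A(M)>0$ for all admissible normal variations with $w\not\equiv0$ on $\bigcup_i M_i$, and *unstable* if $\delta^2A(M)<0$ for some admissible normal variation. **Proposition.** Let $M=(M_i)_{i=1}^{m-1}$ be a connected minimal $m$-phase partitioning of $\Omega$. Then each single interface $M_i$ is a connected minimal two-phase partitioning of $\Omega$ (its phases being the two components of $\Omega\setminus M_i$, and its area functional being $A(M_i)$), and: 1. $M$ is stable if and only if each $M_i$ $(i=1,\dots,m-1)$ is stable as a two-phase partitioning of $\Omega$; 2. $M$ is unstable if and only if at least one $M_i$ $(i=1,\dots,m-1)$ is unstable as a two-phase partitioning of $\Omega$. -/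

import Mathlib

open Set Filter Topology MeasureTheory

noncomputable section

namespace PhasePartition

/-- `σ` is a `C²` defining function of `Ω` near the point `p`. -/
structure IsBoundaryFunction {N : ℕ} (Ω : Set (EuclideanSpace ℝ (Fin N)))
    (σ : EuclideanSpace ℝ (Fin N) → ℝ) (p : EuclideanSpace ℝ (Fin N)) : Prop where
  contDiff : ContDiff ℝ 2 σ
  fderiv_ne_zero : fderiv ℝ σ p ≠ 0
  mem_iff : ∀ᶠ x in 𝓝 p, x ∈ Ω ↔ σ x < 0

/-- `Ω` has `C²` boundary. -/
def HasC2Boundary {N : ℕ} (Ω : Set (EuclideanSpace ℝ (Fin N))) : Prop :=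
  ∀ p ∈ frontier Ω, ∃ σ, IsBoundaryFunction Ω σ p

/-- The phases determined by the family of interfaces `M`: the connected components of
`Ω \ ⋃ i, M i`. -/
def phases {N : ℕ} {ι : Type} (Ω : Set (EuclideanSpace ℝ (Fin N)))
    (M : ι → Set (EuclideanSpace ℝ (Fin N))) : Set (Set (EuclideanSpace ℝ (Fin N))) :=
  {C | ∃ x ∈ Ω \ ⋃ i, M i, C = connectedComponentIn (Ω \ ⋃ i, M i) x}

/-- Near `p`, the set `S` is the part in `closure Ω` of a regular level set `ρ = 0` of a `C²`
function, `A` is the part of `Ω` where `ρ < 0` and `B` is the part where `ρ > 0`. If `p` lies on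
the boundary of `Ω`, the level set is transversal to that boundary. Thus `S` is, near `p`, a `C²`
hypersurface with `C²` boundary `S ∩ frontier Ω`. -/
def SeparatesAt {N : ℕ} (Ω S A B : Set (EuclideanSpace ℝ (Fin N)))
    (p : EuclideanSpace ℝ (Fin N)) : Prop :=
  ∃ ρ : EuclideanSpace ℝ (Fin N) → ℝ, ContDiff ℝ 2 ρ ∧ fderiv ℝ ρ p ≠ 0 ∧
    (∀ᶠ x in 𝓝 p, x ∈ S ↔ x ∈ closure Ω ∧ ρ x = 0) ∧
    (∀ᶠ x in 𝓝 p, x ∈ A ↔ x ∈ Ω ∧ ρ x < 0) ∧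
    (∀ᶠ x in 𝓝 p, x ∈ B ↔ x ∈ Ω ∧ 0 < ρ x) ∧
    (p ∈ frontier Ω → ∃ σ, IsBoundaryFunction Ω σ p ∧
      LinearIndependent ℝ ![fderiv ℝ ρ p, fderiv ℝ σ p])

/-- `M = (M i)` is a connected `m`-phase partitioning of `Ω`: the interfaces `M i` are nonempty,
compact, pairwise disjoint `C²` hypersurfaces in `closure Ω` whose boundary is
`M i ∩ frontier Ω`; there are exactly `m` phases, which are connected; and each `M i` is the
interface between two of the phases. -/
structure IsConnectedPartitioning {N : ℕ} {ι : Type} (Ω : Set (EuclideanSpace ℝ (Fin N)))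
    (M : ι → Set (EuclideanSpace ℝ (Fin N))) (m : ℕ) : Prop where
  nonempty : ∀ i, (M i).Nonempty
  isCompact : ∀ i, IsCompact (M i)
  subset_closure : ∀ i, M i ⊆ closure Ω
  disjoint : Pairwise fun i j => Disjoint (M i) (M j)
  card_phases : (phases Ω M).encard = m
  separates : ∀ i, ∃ A ∈ phases Ω M, ∃ B ∈ phases Ω M, ∀ p ∈ M i, SeparatesAt Ω (M i) A B p

/-- The first variation field (velocity field) `w(x) = ∂ξ/∂t (x, 0)` of a family of maps. -/
def velocity {N : ℕ} (ξ : ℝ → EuclideanSpace ℝ (Fin N) → EuclideanSpace ℝ (Fin N))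
    (x : EuclideanSpace ℝ (Fin N)) : EuclideanSpace ℝ (Fin N) :=
  deriv (fun t => ξ t x) 0

/-- `(ξ t)`, `|t| < δ`, is a variation of `M`: a family of `C²` diffeomorphisms, jointly `C²` in
`(t, x)`, starting at the identity and equal to the identity off a fixed compact set, which in a
neighbourhood of `M` is the solution of `dξ/dt = w(ξ)`, `w` being its velocity field. -/
structure IsVariation {N : ℕ} {ι : Type} (M : ι → Set (EuclideanSpace ℝ (Fin N)))
    (ξ : ℝ → EuclideanSpace ℝ (Fin N) → EuclideanSpace ℝ (Fin N)) (δ : ℝ) : Prop where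
  pos : 0 < δ
  contDiffOn : ContDiffOn ℝ 2 (fun q : ℝ × EuclideanSpace ℝ (Fin N) => ξ q.1 q.2)
    (Ioo (-δ) δ ×ˢ univ)
  diffeo : ∀ t ∈ Ioo (-δ) δ, ∃ η : EuclideanSpace ℝ (Fin N) → EuclideanSpace ℝ (Fin N),
    ContDiff ℝ 2 η ∧ Function.LeftInverse η (ξ t) ∧ Function.RightInverse η (ξ t)
  zero : ∀ x, ξ 0 x = x
  compact_support : ∃ K : Set (EuclideanSpace ℝ (Fin N)), IsCompact K ∧
    ∀ t ∈ Ioo (-δ) δ, ∀ x, x ∉ K → ξ t x = x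
  flow : ∃ V : Set (EuclideanSpace ℝ (Fin N)), IsOpen V ∧ (⋃ i, M i) ⊆ V ∧
    ∀ t ∈ Ioo (-δ) δ, ∀ x ∈ V, HasDerivAt (fun s => ξ s x) (velocity ξ (ξ t x)) t

/-- Admissible variations of the partitioning `M` of `Ω`: those that preserve the boundary of `Ω`
and the volume of every phase. -/
def IsAdmissible {N : ℕ} {ι : Type} (Ω : Set (EuclideanSpace ℝ (Fin N)))
    (M : ι → Set (EuclideanSpace ℝ (Fin N)))
    (ξ : ℝ → EuclideanSpace ℝ (Fin N) → EuclideanSpace ℝ (Fin N)) : Prop :=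
  ∃ δ, IsVariation M ξ δ ∧
    (∀ t ∈ Ioo (-δ) δ, ξ t '' frontier Ω = frontier Ω) ∧
    (∀ t ∈ Ioo (-δ) δ, ∀ C ∈ phases Ω M, volume (ξ t '' C) = volume C)

/-- Normal variations: the velocity is orthogonal to the tangent space of `M i` at each point of
each `M i`. -/
def IsNormal {N : ℕ} {ι : Type} (M : ι → Set (EuclideanSpace ℝ (Fin N)))
    (ξ : ℝ → EuclideanSpace ℝ (Fin N) → EuclideanSpace ℝ (Fin N)) : Prop :=
  ∀ i, ∀ p ∈ M i, velocity ξ p ∈ (Submodule.span ℝ (tangentConeAt ℝ (M i) p))ᗮ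

/-- The area, that is the `(N - 1)`-dimensional Hausdorff measure (normalized to agree with
Lebesgue measure on hyperplanes). -/
def area {N : ℕ} (S : Set (EuclideanSpace ℝ (Fin N))) : ℝ :=
  (Measure.euclideanHausdorffMeasure (N - 1) S).toReal

/-- The weighted area functional `A(M) = ∑ i, γ i * A(M i)`. -/
def totalArea {N : ℕ} {ι : Type} [Fintype ι] (γ : ι → ℝ)
    (M : ι → Set (EuclideanSpace ℝ (Fin N))) : ℝ :=
  ∑ i, γ i * area (M i)

/-- `g` is twice differentiable at `0`, with second derivative `c` there. -/
def HasSecondDerivAtZero (g : ℝ → ℝ) (c : ℝ) : Prop :=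
  ∃ g' : ℝ → ℝ, (∀ᶠ t in 𝓝 0, HasDerivAt g (g' t) t) ∧ HasDerivAt g' c 0

/-- The second variation of area `δ²A(M) = d²/dt² A(ξ t (M))` at `t = 0` exists, on each
interface as well as on `M`, and its value on `M` is `c`. -/
def HasSecondVariation {N : ℕ} {ι : Type} [Fintype ι] (γ : ι → ℝ)
    (M : ι → Set (EuclideanSpace ℝ (Fin N)))
    (ξ : ℝ → EuclideanSpace ℝ (Fin N) → EuclideanSpace ℝ (Fin N)) (c : ℝ) : Prop :=
  (∀ i, ∃ b, HasSecondDerivAtZero (fun t => area (ξ t '' M i)) b) ∧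
    HasSecondDerivAtZero (fun t => totalArea γ fun i => ξ t '' M i) c

/-- `M` is minimal: the first variation of area vanishes for all admissible variations. -/
def IsMinimal {N : ℕ} {ι : Type} [Fintype ι] (Ω : Set (EuclideanSpace ℝ (Fin N))) (γ : ι → ℝ)
    (M : ι → Set (EuclideanSpace ℝ (Fin N))) : Prop :=
  ∀ ξ, IsAdmissible Ω M ξ → HasDerivAt (fun t => totalArea γ fun i => ξ t '' M i) 0 0

/-- `M` is stable: it is minimal, and the second variation of area is positive for all admissible
normal variations whose velocity field does not vanish identically on `M`. -/
def IsStable {N : ℕ} {ι : Type} [Fintype ι] (Ω : Set (EuclideanSpace ℝ (Fin N))) (γ : ι → ℝ)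
    (M : ι → Set (EuclideanSpace ℝ (Fin N))) : Prop :=
  IsMinimal Ω γ M ∧ ∀ ξ, IsAdmissible Ω M ξ → IsNormal M ξ →
    (∃ i, ∃ p ∈ M i, velocity ξ p ≠ 0) → ∃ c, 0 < c ∧ HasSecondVariation γ M ξ c

/-- `M` is unstable: it is minimal, and the second variation of area is negative for some
admissible normal variation. -/
def IsUnstable {N : ℕ} {ι : Type} [Fintype ι] (Ω : Set (EuclideanSpace ℝ (Fin N))) (γ : ι → ℝ)
    (M : ι → Set (EuclideanSpace ℝ (Fin N))) : Prop :=
  IsMinimal Ω γ M ∧ ∃ ξ, IsAdmissible Ω M ξ ∧ IsNormal M ξ ∧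
    ∃ c, c < 0 ∧ HasSecondVariation γ M ξ c

end PhasePartition

end

/-!
Let `Ω` be connected, cut into `m` phases by `m - 1` interfaces. The graph whose vertices are the
phases and whose edges are the interfaces is connected with `m - 1` edges, hence a tree, so each
interface alone cuts `Ω` into exactly two components. This is proved by counting components:
removing one more interface from an open set creates at most one new component
(`encard_components_diff_le`), and all `m - 1` of them together create exactly `m - 1`
(`exists_components_diff_eq_pair`).

The statements on variations rest on passing between `M` and a single interface `M i`.

* An admissible variation of `M` is admissible for `M i` (`IsAdmissible.single`): a component of
  `Ω \ M i` is a union of phases up to the other interfaces, which are null sets, and diffeomorphisms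
  preserve null sets.
* An admissible variation `ξ` of `M i` can be localized to an admissible variation of `M` that agrees
  with `ξ` near `M i` and fixes the other interfaces (`IsAdmissible.exists_localization`). The
  localization is `x ↦ ξ (φ x * t) x` with a cutoff function `φ` that is `1` near `M i`. It moves
  points along trajectories of `ξ`, so it preserves `∂Ω`; it is `C²` and close to the identity for
  small `t`, so it is a diffeomorphism. It preserves `Ω`, as `ξ t` does, and agrees with `ξ t` near
  `M i`; so the two map the components of `Ω \ M i` to the same sets, whose volumes are unchanged.
  Since a phase adjacent to `M i` agrees near `M i` with a component of `Ω \ M i`, and elsewhere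
  nothing moves, the volumes of all phases are unchanged as well.

The area being additive over the interfaces, minimality passes to `M i`, and the second variation of
`M` is the weighted sum of those of the `M i`, with positive weights. An interface on which the
velocity vanishes is fixed, by uniqueness of solutions of `dξ/dt = w(ξ)`, and contributes `0`
(`IsVariation.image_eq_of_velocity_eq_zero`). Both equivalences follow.
-/

noncomputable section

namespace PhasePartition

/-! ### Connected components and removal of interfaces -/

section Components

variable {α : Type*} [TopologicalSpace α]

/-- The set of connected components of the subset `X`. -/
def components (X : Set α) : Set (Set α) :=
  {C | ∃ x ∈ X, C = connectedComponentIn X x}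

theorem connectedComponentIn_mem_components {X : Set α} {x : α} (hx : x ∈ X) :
    connectedComponentIn X x ∈ components X :=
  ⟨x, hx, rfl⟩

theorem eq_connectedComponentIn_of_mem {X C : Set α} (hC : C ∈ components X) {x : α}
    (hx : x ∈ C) : C = connectedComponentIn X x := by
  obtain ⟨y, -, rfl⟩ := hC
  exact connectedComponentIn_eq hx

theorem subset_of_mem_components {X C : Set α} (hC : C ∈ components X) : C ⊆ X := by
  obtain ⟨y, -, rfl⟩ := hC
  exact connectedComponentIn_subset _ _

theorem nonempty_of_mem_components {X C : Set α} (hC : C ∈ components X) : C.Nonempty := by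
  obtain ⟨y, hy, rfl⟩ := hC
  exact ⟨y, mem_connectedComponentIn hy⟩

theorem isPreconnected_of_mem_components {X C : Set α} (hC : C ∈ components X) :
    IsPreconnected C := by
  obtain ⟨y, -, rfl⟩ := hC
  exact isPreconnected_connectedComponentIn

theorem isOpen_of_mem_components [LocallyConnectedSpace α] {X C : Set α} (hX : IsOpen X)
    (hC : C ∈ components X) : IsOpen C := by
  obtain ⟨y, -, rfl⟩ := hC
  exact hX.connectedComponentIn

theorem eq_of_mem_components {X C D : Set α} (hC : C ∈ components X) (hD : D ∈ components X)
    {x : α} (hxC : x ∈ C) (hxD : x ∈ D) : C = D := by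
  rw [eq_connectedComponentIn_of_mem hC hxC, eq_connectedComponentIn_of_mem hD hxD]

theorem disjoint_of_mem_components {X C D : Set α} (hC : C ∈ components X)
    (hD : D ∈ components X) (hCD : C ≠ D) : Disjoint C D :=
  Set.disjoint_left.2 fun _ h h' => hCD (eq_of_mem_components hC hD h h')

theorem subset_of_mem_components_of_inter_nonempty {X C S : Set α} (hC : C ∈ components X)
    (hS : IsPreconnected S) (hSX : S ⊆ X) (h : (S ∩ C).Nonempty) : S ⊆ C := by
  obtain ⟨x, hxS, hxC⟩ := h
  rw [eq_connectedComponentIn_of_mem hC hxC]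
  exact hS.subset_connectedComponentIn hxS hSX

theorem exists_components_superset {X Y A : Set α} (hXY : X ⊆ Y) (hA : A ∈ components X) :
    ∃ U ∈ components Y, A ⊆ U := by
  obtain ⟨x, hx, rfl⟩ := hA
  exact ⟨_, connectedComponentIn_mem_components (hXY hx), connectedComponentIn_mono x hXY⟩

/-- A component of `X \ S` that does not accumulate at `S` is still a component of `X`. -/
theorem mem_components_of_closure_disjoint [LocallyConnectedSpace α] {X S C : Set α}
    (hX : IsOpen X) (hS : IsClosed S) (hC : C ∈ components (X \ S))
    (h : ∀ p ∈ X ∩ S, p ∉ closure C) : C ∈ components X := by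
  have hopen : IsOpen C := isOpen_of_mem_components (hX.sdiff hS) hC
  obtain ⟨x, hx⟩ := nonempty_of_mem_components hC
  have hxX : x ∈ X := (subset_of_mem_components hC hx).1
  refine ⟨x, hxX, Subset.antisymm ?_ ?_⟩
  · exact (isPreconnected_of_mem_components hC).subset_connectedComponentIn hx
      ((subset_of_mem_components hC).trans sdiff_subset)
  · refine isPreconnected_connectedComponentIn.subset_of_closure_inter_subset hopen
      ⟨x, mem_connectedComponentIn hxX, hx⟩ ?_
    rintro y ⟨hy, hyX⟩
    have hyX := connectedComponentIn_subset _ _ hyX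
    have hyS : y ∉ S := fun hyS => h y ⟨hyX, hyS⟩ hy
    -- the component of `y` in `X \ S` is a neighbourhood of `y`, hence meets `C`
    have hD : connectedComponentIn (X \ S) y ∈ 𝓝 y :=
      (hX.sdiff hS).connectedComponentIn.mem_nhds (mem_connectedComponentIn ⟨hyX, hyS⟩)
    obtain ⟨z, hzD, hzC⟩ := mem_closure_iff_nhds.1 hy _ hD
    rw [eq_of_mem_components hC (connectedComponentIn_mem_components ⟨hyX, hyS⟩) hzC hzD]
    exact mem_connectedComponentIn ⟨hyX, hyS⟩

/-- If near `S` the set `X \ S` is covered by `A ∪ B`, then the components of `X \ S` other than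
those containing `A` and `B` are components of `X`. -/
theorem mem_components_of_ne [LocallyConnectedSpace α] {X S A B UA UB C : Set α}
    (hX : IsOpen X) (hS : IsClosed S)
    (hAB : ∀ p ∈ S, ∀ᶠ x in 𝓝 p, x ∈ X → x ∈ S ∨ x ∈ A ∨ x ∈ B)
    (hUA : UA ∈ components (X \ S)) (hA : A ⊆ UA) (hUB : UB ∈ components (X \ S)) (hB : B ⊆ UB)
    (hC : C ∈ components (X \ S)) (hCA : C ≠ UA) (hCB : C ≠ UB) : C ∈ components X := by
  refine mem_components_of_closure_disjoint hX hS hC fun p hp hpC => ?_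
  obtain ⟨x, hx, hxC⟩ := mem_closure_iff_nhds.1 hpC _ (hAB p hp.2)
  obtain ⟨hxX, hxS⟩ := subset_of_mem_components hC hxC
  rcases hx hxX with h | h | h
  · exact hxS h
  · exact hCA (eq_of_mem_components hC hUA hxC (hA h))
  · exact hCB (eq_of_mem_components hC hUB hxC (hB h))

/-- Removing an interface between two regions creates at most one new component. -/
theorem encard_components_diff_le [LocallyConnectedSpace α] {X S A B UA UB : Set α}
    (hX : IsOpen X) (hS : IsClosed S)
    (hAB : ∀ p ∈ S, ∀ᶠ x in 𝓝 p, x ∈ X → x ∈ S ∨ x ∈ A ∨ x ∈ B)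
    (hUA : UA ∈ components (X \ S)) (hA : A ⊆ UA) (hUB : UB ∈ components (X \ S))
    (hB : B ⊆ UB) :
    (components (X \ S)).encard ≤ (components X).encard + 1 := by
  have hex : ∀ C : Set α, ∃ D, C ∈ components (X \ S) → D ∈ components X ∧ C ⊆ D := by
    intro C
    by_cases hC : C ∈ components (X \ S)
    · obtain ⟨D, hD, hCD⟩ := exists_components_superset sdiff_subset hC
      exact ⟨D, fun _ => ⟨hD, hCD⟩⟩
    · exact ⟨∅, fun h => absurd h hC⟩
  choose f hf using hex
  -- away from `UB`, sending a component to the component of `X` that contains it is injective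
  have key : ∀ C ∈ components (X \ S) \ {UB}, ∀ C' ∈ components (X \ S) \ {UB}, f C = f C' →
      C ≠ UA → C = C' := by
    intro C hC C' hC' h hCA
    have hCX := mem_components_of_ne hX hS hAB hUA hA hUB hB hC.1 hCA hC.2
    obtain ⟨x, hx⟩ := nonempty_of_mem_components hC.1
    obtain ⟨y, hy⟩ := nonempty_of_mem_components hC'.1
    have hfC : C = f C := eq_of_mem_components hCX (hf C hC.1).1 hx ((hf C hC.1).2 hx)
    refine eq_of_mem_components hC.1 hC'.1 (x := y) ?_ hy
    rw [hfC, h]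
    exact (hf C' hC'.1).2 hy
  have hinj : InjOn f (components (X \ S) \ {UB}) := by
    intro C hC C' hC' h
    by_cases hCA : C = UA
    · by_cases hCA' : C' = UA
      · rw [hCA, hCA']
      · exact (key C' hC' C hC h.symm hCA').symm
    · exact key C hC C' hC' h hCA
  calc (components (X \ S)).encard = (components (X \ S) \ {UB}).encard + 1 :=
        (Set.encard_sdiff_singleton_add_one hUB).symm
    _ ≤ _ := by
        exact add_le_add
          (Set.encard_le_encard_of_injOn (fun C hC => (hf C hC.1).1) hinj) le_rfl

/-- Removing finitely many further interfaces from `Ω \ ⋃ i ∈ J, M i` creates at most as many new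
components as there are interfaces removed. -/
theorem encard_components_union_le [LocallyConnectedSpace α] {ι : Type*} [DecidableEq ι]
    {Ω : Set α} {M A B : ι → Set α} (hΩ : IsOpen Ω) (hM : ∀ i, IsClosed (M i))
    (hA : ∀ i, A i ∈ components (Ω \ ⋃ i, M i)) (hB : ∀ i, B i ∈ components (Ω \ ⋃ i, M i))
    (hAB : ∀ i, ∀ p ∈ M i, ∀ᶠ x in 𝓝 p, x ∈ Ω → x ∈ M i ∨ x ∈ A i ∨ x ∈ B i)
    (J K : Finset ι) (hJK : Disjoint J K) :
    (components (Ω \ ⋃ i ∈ J ∪ K, M i)).encard ≤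
      (components (Ω \ ⋃ i ∈ J, M i)).encard + K.card := by
  induction K using Finset.induction_on with
  | empty => simp
  | insert k K hk ih =>
    have hJK' := (Finset.disjoint_insert_right.1 hJK)
    have hset : Ω \ ⋃ i ∈ J ∪ insert k K, M i = (Ω \ ⋃ i ∈ J ∪ K, M i) \ M k := by
      rw [Finset.union_insert, Finset.set_biUnion_insert, union_comm, sdiff_sdiff]
    have hsub : Ω \ ⋃ i, M i ⊆ (Ω \ ⋃ i ∈ J ∪ K, M i) \ M k := by
      rintro x ⟨hx, hx'⟩
      simp only [mem_iUnion, not_exists] at hx'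
      refine ⟨⟨hx, ?_⟩, hx' k⟩
      simp only [mem_iUnion, not_exists]
      exact fun i _ => hx' i
    obtain ⟨UA, hUA, hAU⟩ := exists_components_superset hsub (hA k)
    obtain ⟨UB, hUB, hBU⟩ := exists_components_superset hsub (hB k)
    have hopen : IsOpen (Ω \ ⋃ i ∈ J ∪ K, M i) :=
      hΩ.sdiff (isClosed_biUnion_finset fun i _ => hM i)
    have h1 := encard_components_diff_le hopen (hM k)
      (fun p hp => (hAB k p hp).mono fun x hx hxX => hx hxX.1) hUA hAU hUB hBU
    rw [hset, Finset.card_insert_of_notMem hk, Nat.cast_add, Nat.cast_one, ← add_assoc]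
    exact h1.trans (by gcongr; exact ih hJK'.2)

/-- If `m - 1` interfaces cut the connected open set `Ω` into `m` components (so that the
adjacency graph of the components is a tree), each interface alone cuts `Ω` into exactly two. -/
theorem exists_components_diff_eq_pair [LocallyConnectedSpace α] {m : ℕ}
    {Ω : Set α} {M A B : Fin (m - 1) → Set α} (hΩ : IsOpen Ω) (hΩc : IsConnected Ω)
    (hM : ∀ i, IsClosed (M i))
    (hA : ∀ i, A i ∈ components (Ω \ ⋃ i, M i)) (hB : ∀ i, B i ∈ components (Ω \ ⋃ i, M i))
    (hAB : ∀ i, ∀ p ∈ M i, ∀ᶠ x in 𝓝 p, x ∈ Ω → x ∈ M i ∨ x ∈ A i ∨ x ∈ B i)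
    (hcard : (components (Ω \ ⋃ i, M i)).encard = m) (i : Fin (m - 1)) :
    ∃ UA UB, components (Ω \ M i) = {UA, UB} ∧ UA ≠ UB ∧ A i ⊆ UA ∧ B i ⊆ UB := by
  have hsub : Ω \ ⋃ i, M i ⊆ Ω \ M i := sdiff_subset_sdiff_right (subset_iUnion M i)
  obtain ⟨UA, hUA, hAU⟩ := exists_components_superset hsub (hA i)
  obtain ⟨UB, hUB, hBU⟩ := exists_components_superset hsub (hB i)
  have hJK : Disjoint ({i} : Finset (Fin (m - 1))) (Finset.univ.erase i) := by simp
  have h := encard_components_union_le hΩ hM hA hB hAB {i} (Finset.univ.erase i) hJK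
  have hun : ({i} ∪ Finset.univ.erase i : Finset (Fin (m - 1))) = Finset.univ := by
    ext j; simp
  rw [hun] at h
  simp only [Finset.mem_univ, iUnion_true, hcard, Finset.mem_singleton, iUnion_iUnion_eq_left,
    Finset.card_erase_of_mem, Finset.card_univ, Fintype.card_fin] at h
  have hm : 2 ≤ m := by have := i.2; omega
  have hge : 2 ≤ (components (Ω \ M i)).encard := by
    by_contra hlt
    have hle : (components (Ω \ M i)).encard ≤ 1 := by
      rw [not_le] at hlt
      exact Order.lt_add_one_iff_of_not_isMax (by simp) |>.1 (by simpa [one_add_one_eq_two] using hlt)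
    have : (m : ℕ∞) ≤ 1 + ((m - 1 - 1 : ℕ) : ℕ∞) := h.trans (by gcongr)
    have : m ≤ 1 + (m - 1 - 1) := by exact_mod_cast this
    omega
  -- a third component would be a component of the connected set `Ω`, hence all of it
  have hpair : components (Ω \ M i) ⊆ {UA, UB} := by
    intro C hC
    by_contra hne
    simp only [mem_insert_iff, mem_singleton_iff, not_or] at hne
    have hCΩ := mem_components_of_ne hΩ (hM i) (hAB i) hUA hAU hUB hBU hC hne.1 hne.2
    obtain ⟨x, hx, hCx⟩ := hCΩ
    rw [hΩc.isPreconnected.connectedComponentIn hx] at hCx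
    obtain ⟨y, hy⟩ := nonempty_of_mem_components hUA
    exact hne.1 (eq_of_mem_components hC hUA
      (by rw [hCx]; exact (subset_of_mem_components hUA hy).1) hy)
  refine ⟨UA, UB, Subset.antisymm hpair ?_, ?_, hAU, hBU⟩
  · rintro C (rfl | rfl)
    exacts [hUA, hUB]
  · rintro rfl
    have := hge.trans (Set.encard_le_encard hpair)
    simp at this

/-- The image of a component of `Ω \ S` under a homeomorphism preserving `Ω` only depends on the
homeomorphism near `S`. -/
theorem image_component_eq_of_eqOn [LocallyConnectedSpace α] {Ω S U V : Set α} (hΩ : IsOpen Ω)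
    (hΩc : IsConnected Ω) (hS : IsClosed S) (hU : U ∈ components (Ω \ S)) (hUΩ : U ≠ Ω)
    (hV : IsOpen V) (hSV : S ⊆ V) (h k : α ≃ₜ α) (hh : h '' Ω = Ω) (hk : k '' Ω = Ω)
    (heq : EqOn h k V) : h '' U = k '' U := by
  obtain ⟨x, hxU, hxV⟩ : (U ∩ V).Nonempty := by
    by_contra hne
    rw [not_nonempty_iff_eq_empty, ← disjoint_iff_inter_eq_empty] at hne
    have hmem : U ∈ components Ω := by
      refine mem_components_of_closure_disjoint hΩ hS hU fun p hp hpC => ?_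
      exact (Set.disjoint_left.1 (hne.closure_left hV)) hpC (hSV hp.2)
    obtain ⟨x, hx, hUx⟩ := hmem
    exact hUΩ (hUx.trans (hΩc.isPreconnected.connectedComponentIn hx))
  have hxX := subset_of_mem_components hU hxU
  rw [eq_connectedComponentIn_of_mem hU hxU, h.image_connectedComponentIn hxX,
    k.image_connectedComponentIn hxX, image_sdiff h.injective, image_sdiff k.injective, hh, hk,
    heq hxV, (heq.mono hSV).image_eq]

end Components

/-! ### Hypersurfaces are null sets -/

/-- A regular level set of a `C¹` function is a null set: near each of its points, it meets every
line in a fixed transversal direction at most once, so that it has infinitely many disjoint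
translates inside a bounded set. -/
theorem addHaar_eq_zero_of_locally_level_set {E : Type*} [NormedAddCommGroup E]
    [NormedSpace ℝ E] [MeasurableSpace E] [BorelSpace E] [FiniteDimensional ℝ E] (μ : Measure E)
    [μ.IsAddHaarMeasure] {S : Set E} (hS : MeasurableSet S)
    (h : ∀ p ∈ S, ∃ ρ : E → ℝ, ContDiff ℝ 1 ρ ∧ fderiv ℝ ρ p ≠ 0 ∧
      ∀ᶠ x in 𝓝 p, x ∈ S → ρ x = 0) : μ S = 0 := by
  refine measure_null_of_locally_null S fun p hp => ?_
  obtain ⟨ρ, hρ, hne, hlev⟩ := h p hp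
  obtain ⟨v, hv⟩ : ∃ v, fderiv ℝ ρ p v = 1 := by
    obtain ⟨w, hw⟩ : ∃ w, fderiv ℝ ρ p w ≠ 0 := by
      by_contra hcon
      push Not at hcon
      exact hne (ContinuousLinearMap.ext hcon)
    exact ⟨(fderiv ℝ ρ p w)⁻¹ • w, by simp [hw]⟩
  have hstrict : HasStrictFDerivAt ρ (fderiv ℝ ρ p) p := hρ.contDiffAt.hasStrictFDerivAt (by simp)
  have hc : (0 : ℝ) < (2 * (‖v‖ + 1))⁻¹ := by positivity
  have hsmall := (hstrict.isLittleO.def hc)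
  rw [nhds_prod_eq] at hsmall
  obtain ⟨s, hs, hsmall⟩ := eventually_prod_self_iff
    (r := fun y x => ‖ρ y - ρ x - fderiv ℝ ρ p (y - x)‖ ≤ (2 * (‖v‖ + 1))⁻¹ * ‖y - x‖) |>.1 hsmall
  obtain ⟨r, hr, hball⟩ := Metric.mem_nhds_iff.1 (inter_mem hs hlev)
  refine ⟨S ∩ Metric.ball p r, inter_mem_nhdsWithin _ (Metric.ball_mem_nhds p hr), ?_⟩
  refine Measure.addHaar_eq_zero_of_disjoint_translates μ
    (fun n : ℕ => ((n : ℝ) + 1)⁻¹ • v) ?_ ?_ (hS.inter Metric.isOpen_ball.measurableSet)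
  · refine (Metric.isBounded_closedBall (x := (0 : E)) (r := ‖v‖)).subset ?_
    rintro _ ⟨n, rfl⟩
    rw [mem_closedBall_zero_iff, norm_smul, Real.norm_of_nonneg (by positivity)]
    exact mul_le_of_le_one_left (norm_nonneg v)
      (inv_le_one_of_one_le₀ (by linarith [n.cast_nonneg (α := ℝ)]))
  · intro n k hnk
    refine Set.disjoint_left.2 fun z hz hz' => hnk ?_
    obtain ⟨x, ⟨hxS, hxb⟩, rfl⟩ := by simpa only [singleton_add, mem_image] using hz
    obtain ⟨y, ⟨hyS, hyb⟩, hxy⟩ := by simpa only [singleton_add, mem_image] using hz'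
    set a : ℝ := ((n : ℝ) + 1)⁻¹ - ((k : ℝ) + 1)⁻¹ with ha
    have hyx : y - x = a • v := by
      rw [ha, sub_smul, sub_eq_sub_iff_add_eq_add, add_comm y, hxy]
    have h1 := hsmall y (hball hyb).1 x (hball hxb).1
    rw [(hball hyb).2 hyS, (hball hxb).2 hxS, hyx, map_smul, hv, norm_smul] at h1
    simp only [sub_zero, zero_sub, smul_eq_mul, mul_one, norm_neg, Real.norm_eq_abs] at h1
    have h2 : (2 * (‖v‖ + 1))⁻¹ * (|a| * ‖v‖) ≤ |a| / 2 := by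
      rw [inv_mul_le_iff₀ (by positivity)]
      nlinarith [abs_nonneg a, norm_nonneg v]
    have h3 : a = 0 := abs_nonpos_iff.1 (by linarith)
    rw [ha, sub_eq_zero, inv_inj] at h3
    exact_mod_cast add_right_cancel h3

theorem volume_eq_zero_of_separatesAt {N : ℕ} {Ω S A B : Set (EuclideanSpace ℝ (Fin N))}
    (hS : IsCompact S) (h : ∀ p ∈ S, SeparatesAt Ω S A B p) : volume S = 0 := by
  refine addHaar_eq_zero_of_locally_level_set volume hS.measurableSet fun p hp => ?_
  obtain ⟨ρ, hρ, hne, hlev, -⟩ := h p hp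
  exact ⟨ρ, hρ.of_le (by norm_num), hne, hlev.mono fun x hx hxS => (hx.1 hxS).2⟩

/-! ### Second derivatives at the origin -/

theorem HasSecondDerivAtZero.unique {g : ℝ → ℝ} {b c : ℝ} (hb : HasSecondDerivAtZero g b)
    (hc : HasSecondDerivAtZero g c) : b = c := by
  obtain ⟨f, hf, hf'⟩ := hb
  obtain ⟨k, hk, hk'⟩ := hc
  have : f =ᶠ[𝓝 0] k := by
    filter_upwards [hf, hk] with t h1 h2 using h1.unique h2
  exact hf'.unique (hk'.congr_of_eventuallyEq this)

theorem HasSecondDerivAtZero.congr {f g : ℝ → ℝ} {c : ℝ} (hf : HasSecondDerivAtZero f c)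
    (h : f =ᶠ[𝓝 0] g) : HasSecondDerivAtZero g c := by
  obtain ⟨k, hk, hk'⟩ := hf
  refine ⟨k, ?_, hk'⟩
  filter_upwards [hk, h.eventuallyEq_nhds] with t h1 h2
  exact h1.congr_of_eventuallyEq h2.symm

theorem hasSecondDerivAtZero_const (a : ℝ) : HasSecondDerivAtZero (fun _ => a) 0 :=
  ⟨fun _ => 0, Eventually.of_forall fun t => hasDerivAt_const t a, hasDerivAt_const 0 0⟩

theorem HasSecondDerivAtZero.const_mul {f : ℝ → ℝ} {c : ℝ} (hf : HasSecondDerivAtZero f c)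
    (a : ℝ) : HasSecondDerivAtZero (fun t => a * f t) (a * c) := by
  obtain ⟨k, hk, hk'⟩ := hf
  exact ⟨fun t => a * k t, hk.mono fun t h => h.const_mul a, hk'.const_mul a⟩

theorem HasSecondDerivAtZero.sum {ι : Type*} [Fintype ι] {f : ι → ℝ → ℝ} {c : ι → ℝ}
    (hf : ∀ i, HasSecondDerivAtZero (f i) (c i)) :
    HasSecondDerivAtZero (fun t => ∑ i, f i t) (∑ i, c i) := by
  choose k hk hk' using hf
  refine ⟨fun t => ∑ i, k i t, ?_, HasDerivAt.fun_sum fun i _ => hk' i⟩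
  filter_upwards [eventually_all.2 hk] with t h
  exact HasDerivAt.fun_sum fun i _ => h i

/-! ### Basic properties of variations -/

section Variation

variable {N : ℕ} {ι : Type} {M : ι → Set (EuclideanSpace ℝ (Fin N))}
  {ξ : ℝ → EuclideanSpace ℝ (Fin N) → EuclideanSpace ℝ (Fin N)} {δ : ℝ}

theorem isOpen_timeStrip {E : Type*} [TopologicalSpace E] (δ : ℝ) :
    IsOpen (Ioo (-δ) δ ×ˢ (univ : Set E)) :=
  isOpen_Ioo.prod isOpen_univ

theorem IsVariation.zero_mem (h : IsVariation M ξ δ) : (0 : ℝ) ∈ Ioo (-δ) δ :=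
  ⟨neg_neg_of_pos h.pos, h.pos⟩

theorem IsVariation.eventually_mem (h : IsVariation M ξ δ) : ∀ᶠ t in 𝓝 0, t ∈ Ioo (-δ) δ :=
  isOpen_Ioo.mem_nhds h.zero_mem

theorem IsVariation.contDiff_slice (h : IsVariation M ξ δ) {t : ℝ} (ht : t ∈ Ioo (-δ) δ) :
    ContDiff ℝ 2 (ξ t) := by
  have h1 : ContDiff ℝ 2 (fun x : EuclideanSpace ℝ (Fin N) => (t, x)) :=
    contDiff_const.prodMk contDiff_id
  have := h.contDiffOn.comp (contDiffOn_univ.2 h1) (fun x _ => ⟨ht, mem_univ x⟩)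
  exact contDiffOn_univ.1 this

theorem IsVariation.exists_homeomorph (h : IsVariation M ξ δ) {t : ℝ} (ht : t ∈ Ioo (-δ) δ) :
    ∃ e : EuclideanSpace ℝ (Fin N) ≃ₜ EuclideanSpace ℝ (Fin N), ⇑e = ξ t := by
  obtain ⟨η, hη, hl, hr⟩ := h.diffeo t ht
  exact ⟨⟨⟨ξ t, η, hl, hr⟩, (h.contDiff_slice ht).continuous, hη.continuous⟩, rfl⟩

theorem IsVariation.injective (h : IsVariation M ξ δ) {t : ℝ} (ht : t ∈ Ioo (-δ) δ) :
    Function.Injective (ξ t) := by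
  obtain ⟨e, he⟩ := h.exists_homeomorph ht
  exact he ▸ e.injective

theorem IsVariation.surjective (h : IsVariation M ξ δ) {t : ℝ} (ht : t ∈ Ioo (-δ) δ) :
    Function.Surjective (ξ t) := by
  obtain ⟨e, he⟩ := h.exists_homeomorph ht
  exact he ▸ e.surjective

theorem IsVariation.continuousOn_time (h : IsVariation M ξ δ) (x : EuclideanSpace ℝ (Fin N)) :
    ContinuousOn (fun t => ξ t x) (Ioo (-δ) δ) :=
  h.contDiffOn.continuousOn.comp (by fun_prop : ContinuousOn (fun t : ℝ => (t, x)) _)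
    (fun _ ht => ⟨ht, mem_univ x⟩)

/-- A variation that preserves the boundary of `Ω` preserves `Ω`: a trajectory starting off the
boundary never crosses it. -/
theorem IsVariation.mem_iff_of_frontier (h : IsVariation M ξ δ)
    {Ω : Set (EuclideanSpace ℝ (Fin N))} (hΩ : IsOpen Ω)
    (hfr : ∀ t ∈ Ioo (-δ) δ, ξ t '' frontier Ω = frontier Ω) {t : ℝ} (ht : t ∈ Ioo (-δ) δ)
    (x : EuclideanSpace ℝ (Fin N)) : ξ t x ∈ Ω ↔ x ∈ Ω := by
  have hdisj : ∀ y ∈ Ω, y ∉ frontier Ω := fun y hy hy' => by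
    rw [hΩ.frontier_eq] at hy'
    exact hy'.2 hy
  by_cases hx : x ∈ frontier Ω
  · have : ξ t x ∈ frontier Ω := hfr t ht ▸ mem_image_of_mem _ hx
    exact ⟨fun h' => absurd this (hdisj _ h'), fun h' => absurd hx (hdisj _ h')⟩
  · have hpre : IsPreconnected ((fun s => ξ s x) '' Ioo (-δ) δ) :=
      isPreconnected_Ioo.image _ (h.continuousOn_time x)
    have hno : ∀ s ∈ Ioo (-δ) δ, ξ s x ∉ frontier Ω := by
      intro s hs hs'
      rw [← hfr s hs] at hs'
      obtain ⟨y, hy, hyx⟩ := hs'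
      exact hx (h.injective hs hyx ▸ hy)
    have key : ∀ s ∈ Ioo (-δ) δ, ξ s x ∈ Ω → ∀ s' ∈ Ioo (-δ) δ, ξ s' x ∈ Ω := by
      intro s hs hsΩ s' hs'
      refine hpre.subset_of_closure_inter_subset hΩ ⟨ξ s x, ⟨s, hs, rfl⟩, hsΩ⟩ ?_ ⟨s', hs', rfl⟩
      rintro _ ⟨hcl, ⟨r, hr, rfl⟩⟩
      by_contra hn
      exact hno r hr (by rw [hΩ.frontier_eq]; exact ⟨hcl, hn⟩)
    constructor
    · intro h'
      simpa only [h.zero] using key t ht h' 0 h.zero_mem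
    · intro h'
      exact key 0 h.zero_mem (by simpa only [h.zero] using h') t ht

theorem IsVariation.image_eq_of_frontier (h : IsVariation M ξ δ)
    {Ω : Set (EuclideanSpace ℝ (Fin N))} (hΩ : IsOpen Ω)
    (hfr : ∀ t ∈ Ioo (-δ) δ, ξ t '' frontier Ω = frontier Ω) {t : ℝ} (ht : t ∈ Ioo (-δ) δ) :
    ξ t '' Ω = Ω := by
  ext y
  constructor
  · rintro ⟨x, hx, rfl⟩
    exact (h.mem_iff_of_frontier hΩ hfr ht x).2 hx
  · intro hy
    obtain ⟨x, rfl⟩ := h.surjective ht y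
    exact ⟨x, (h.mem_iff_of_frontier hΩ hfr ht x).1 hy, rfl⟩

theorem IsVariation.volume_image_eq_zero (h : IsVariation M ξ δ) {t : ℝ} (ht : t ∈ Ioo (-δ) δ)
    {S : Set (EuclideanSpace ℝ (Fin N))} (hS : volume S = 0) : volume (ξ t '' S) = 0 :=
  addHaar_image_eq_zero_of_differentiableOn_of_addHaar_eq_zero _
    ((h.contDiff_slice ht).differentiable (by norm_num)).differentiableOn hS

/-- The velocity field is `C¹` with compact support. -/
theorem IsVariation.exists_lipschitzWith_velocity (h : IsVariation M ξ δ) :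
    ∃ C, LipschitzWith C (velocity ξ) := by
  obtain ⟨K, hK, hKx⟩ := h.compact_support
  have hsupp : HasCompactSupport (velocity ξ) := by
    refine HasCompactSupport.intro hK fun x hx => ?_
    have : (fun t => ξ t x) =ᶠ[𝓝 0] fun _ => x :=
      h.eventually_mem.mono fun t ht => hKx t ht x hx
    rw [velocity, this.deriv_eq, deriv_const]
  have hF : ∀ x, ContDiffAt ℝ 2
      (fun q : ℝ × EuclideanSpace ℝ (Fin N) => ξ q.1 q.2) (0, x) := fun x =>
    h.contDiffOn.contDiffAt ((isOpen_timeStrip δ).mem_nhds ⟨h.zero_mem, mem_univ x⟩)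
  have heq : velocity ξ = fun x =>
      fderiv ℝ (fun q : ℝ × EuclideanSpace ℝ (Fin N) => ξ q.1 q.2) (0, x) (1, 0) := by
    funext x
    have h1 : HasDerivAt (fun t : ℝ => (t, x)) ((1 : ℝ), (0 : EuclideanSpace ℝ (Fin N))) 0 :=
      (hasDerivAt_id 0).prodMk (hasDerivAt_const 0 x)
    have h2 := ((hF x).differentiableAt (by norm_num)).hasFDerivAt
    exact (h2.comp_hasDerivAt (0 : ℝ) h1).deriv
  have hC1 : ContDiff ℝ 1 (velocity ξ) := by
    rw [heq, contDiff_iff_contDiffAt]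
    intro x
    have h1 : ContDiffAt ℝ 1
        (fderiv ℝ (fun q : ℝ × EuclideanSpace ℝ (Fin N) => ξ q.1 q.2)) (0, x) :=
      (hF x).fderiv_right (by norm_num)
    have h2 : ContDiffAt ℝ 1 (fun y : EuclideanSpace ℝ (Fin N) => ((0 : ℝ), y)) x :=
      contDiffAt_const.prodMk contDiffAt_id
    exact (h1.comp x h2).clm_apply contDiffAt_const
  exact hC1.lipschitzWith_of_hasCompactSupport hsupp (by norm_num)

/-- Points of the interfaces where the velocity vanishes do not move, by uniqueness of solutions
of `dξ/dt = w(ξ)`. -/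
theorem IsVariation.apply_eq_of_velocity_eq_zero (h : IsVariation M ξ δ) {i : ι}
    {x : EuclideanSpace ℝ (Fin N)} (hx : x ∈ M i) (hv : velocity ξ x = 0) {t : ℝ}
    (ht : t ∈ Ioo (-δ) δ) : ξ t x = x := by
  obtain ⟨V, -, hMV, hflow⟩ := h.flow
  obtain ⟨C, hC⟩ := h.exists_lipschitzWith_velocity
  have hxV : x ∈ V := hMV (mem_iUnion_of_mem i hx)
  refine ODE_solution_unique_of_mem_Ioo (v := fun _ => velocity ξ) (s := fun _ => univ) (K := C)
    (f := fun s => ξ s x) (g := fun _ => x) (fun _ _ => hC.lipschitzOnWith) h.zero_mem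
    (fun s hs => ⟨hflow s hs x hxV, mem_univ _⟩) (fun s _ => ⟨?_, mem_univ _⟩) (h.zero x) ht
  simpa only [hv] using hasDerivAt_const s x

theorem IsVariation.image_eq_of_velocity_eq_zero (h : IsVariation M ξ δ) {i : ι}
    (hv : ∀ x ∈ M i, velocity ξ x = 0) {t : ℝ} (ht : t ∈ Ioo (-δ) δ) : ξ t '' M i = M i := by
  have : EqOn (ξ t) id (M i) := fun x hx => h.apply_eq_of_velocity_eq_zero hx (hv x hx) ht
  rw [this.image_eq, image_id]

theorem IsVariation.single (h : IsVariation M ξ δ) (i : ι) :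
    IsVariation (fun _ : Unit => M i) ξ δ where
  pos := h.pos
  contDiffOn := h.contDiffOn
  diffeo := h.diffeo
  zero := h.zero
  compact_support := h.compact_support
  flow := by
    obtain ⟨V, hV, hMV, hflow⟩ := h.flow
    exact ⟨V, hV, iUnion_subset fun _ => (subset_iUnion M i).trans hMV, hflow⟩

end Variation

/-! ### Small perturbations of the identity are diffeomorphisms -/

theorem exists_contDiff_inverse_of_fderiv_close {E : Type*} [NormedAddCommGroup E]
    [NormedSpace ℝ E] [CompleteSpace E] {f : E → E} (hf : ContDiff ℝ 2 f)
    (hclose : ∀ x, ‖fderiv ℝ f x - ContinuousLinearMap.id ℝ E‖ ≤ 1 / 2) :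
    ∃ η : E → E, ContDiff ℝ 2 η ∧ Function.LeftInverse η f ∧ Function.RightInverse η f := by
  have hdiff : Differentiable ℝ f := hf.differentiable (by norm_num)
  have hlip : LipschitzWith (1 / 2) (fun x => f x - x) := by
    refine lipschitzWith_of_nnnorm_fderiv_le (𝕜 := ℝ) (hdiff.sub differentiable_id) fun x => ?_
    have : fderiv ℝ (fun x => f x - x) x = fderiv ℝ f x - ContinuousLinearMap.id ℝ E :=
      ((hdiff x).hasFDerivAt.sub (hasFDerivAt_id x)).fderiv
    rw [this, ← NNReal.coe_le_coe]
    simpa using hclose x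
  have happrox : ApproximatesLinearOn f
      ((ContinuousLinearEquiv.refl ℝ E : E ≃L[ℝ] E) : E →L[ℝ] E) univ (1 / 2) := by
    intro x _ y _
    have := hlip.norm_sub_le x y
    simpa [sub_sub_sub_comm] using this
  have hc : Subsingleton E ∨ (1 / 2 : NNReal) <
      ‖((ContinuousLinearEquiv.refl ℝ E).symm : E →L[ℝ] E)‖₊⁻¹ := by
    rcases subsingleton_or_nontrivial E with h | h
    · exact Or.inl h
    · right
      have : ‖((ContinuousLinearEquiv.refl ℝ E).symm : E →L[ℝ] E)‖₊ = 1 := by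
        rw [← NNReal.coe_inj]
        exact ContinuousLinearMap.norm_id
      rw [this, inv_one, ← NNReal.coe_lt_coe]
      norm_num
  set e : E ≃ₜ E := happrox.toHomeomorph f hc
  have hinv : ∀ x, ∃ L : E ≃L[ℝ] E, (L : E →L[ℝ] E) = fderiv ℝ f x := by
    intro x
    have hlt : ‖ContinuousLinearMap.id ℝ E - fderiv ℝ f x‖ < 1 := by
      rw [norm_sub_rev]
      exact (hclose x).trans_lt (by norm_num)
    obtain ⟨u, hu⟩ := isUnit_one_sub_of_norm_lt_one hlt
    refine ⟨ContinuousLinearEquiv.unitsEquiv ℝ E u, ?_⟩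
    ext y
    have := congrArg (fun T : E →L[ℝ] E => T y) hu
    simpa using this
  choose L hL using hinv
  refine ⟨e.symm, e.contDiff_symm (f₀' := L) (fun x => ?_) hf, e.symm_apply_apply,
    e.apply_symm_apply⟩
  rw [hL]
  exact (hdiff x).hasFDerivAt

/-- The spatial derivative of a `C²` deformation of the identity supported in a fixed compact set
is uniformly close to the identity for small times. -/
theorem eventually_fderiv_close {E : Type*} [NormedAddCommGroup E] [NormedSpace ℝ E]
    {ξ : ℝ → E → E} {δ : ℝ} (hδ : 0 < δ)
    (hξ : ContDiffOn ℝ 2 (fun q : ℝ × E => ξ q.1 q.2) (Ioo (-δ) δ ×ˢ univ))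
    (hzero : ∀ x, ξ 0 x = x) {K : Set E} (hK : IsCompact K)
    (hKx : ∀ t ∈ Ioo (-δ) δ, ∀ x, x ∉ K → ξ t x = x) :
    ∀ᶠ t in 𝓝 0, ∀ x, ‖fderiv ℝ (ξ t) x - ContinuousLinearMap.id ℝ E‖ ≤ 1 / 2 := by
  have hopen : IsOpen (Ioo (-δ) δ ×ˢ (univ : Set E)) := isOpen_timeStrip δ
  have h0 : (0 : ℝ) ∈ Ioo (-δ) δ := ⟨neg_neg_of_pos hδ, hδ⟩
  set F : ℝ × E → E := fun q => ξ q.1 q.2 with hF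
  have hslice : ∀ t ∈ Ioo (-δ) δ, ∀ x,
      fderiv ℝ (ξ t) x = (fderiv ℝ F (t, x)).comp (ContinuousLinearMap.inr ℝ ℝ E) := by
    intro t ht x
    have h1 : HasFDerivAt F (fderiv ℝ F (t, x)) (t, x) :=
      ((hξ.contDiffAt (hopen.mem_nhds ⟨ht, mem_univ x⟩)).differentiableAt
        (by norm_num)).hasFDerivAt
    exact (h1.comp x (hasFDerivAt_prodMk_right t x)).fderiv
  have hcont : ∀ t ∈ Ioo (-δ) δ, ∀ x, ContinuousAt
      (fun q : ℝ × E => (fderiv ℝ F q).comp (ContinuousLinearMap.inr ℝ ℝ E)) (t, x) := by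
    intro t ht x
    have h1 : ContinuousAt (fderiv ℝ F) (t, x) :=
      ((hξ.contDiffAt (hopen.mem_nhds ⟨ht, mem_univ x⟩)).fderiv_right (m := 1)
        (by norm_num)).continuousAt
    exact h1.clm_comp continuousAt_const
  have hid : ∀ x, (fderiv ℝ F (0, x)).comp (ContinuousLinearMap.inr ℝ ℝ E) =
      ContinuousLinearMap.id ℝ E := by
    intro x
    rw [← hslice 0 h0 x]
    have : ξ 0 = id := funext hzero
    rw [this, fderiv_id]
  have hclose : ∀ᶠ t in 𝓝 (0 : ℝ), ∀ x ∈ K,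
      ‖(fderiv ℝ F (t, x)).comp (ContinuousLinearMap.inr ℝ ℝ E) -
        ContinuousLinearMap.id ℝ E‖ < 1 / 2 := by
    refine hK.eventually_forall_of_forall_eventually (P := fun t x =>
      ‖(fderiv ℝ F (t, x)).comp (ContinuousLinearMap.inr ℝ ℝ E) -
        ContinuousLinearMap.id ℝ E‖ < 1 / 2) fun x _ => ?_
    have h1 : ContinuousAt (fun q : ℝ × E =>
        ‖(fderiv ℝ F q).comp (ContinuousLinearMap.inr ℝ ℝ E) -
          ContinuousLinearMap.id ℝ E‖) (0, x) := ((hcont 0 h0 x).sub continuousAt_const).norm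
    exact h1.eventually_lt continuousAt_const (by rw [hid x]; simp)
  filter_upwards [hclose, isOpen_Ioo.mem_nhds h0] with t ht htδ x
  by_cases hx : x ∈ K
  · rw [hslice t htδ x]
    exact (ht x hx).le
  · have : ξ t =ᶠ[𝓝 x] id := by
      filter_upwards [hK.isClosed.isOpen_compl.mem_nhds hx] with y hy using hKx t htδ y hy
    rw [this.fderiv_eq, fderiv_id, sub_self, norm_zero]
    norm_num

/-! ### Localization of a variation near one interface -/

section Cutoff

variable {N : ℕ}

/-- The variation `ξ` slowed down by the factor `φ x` at the point `x`. Being carried out along the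
trajectories of `ξ`, this localization keeps every hypersurface invariant that `ξ` does. -/
def cutoff (φ : EuclideanSpace ℝ (Fin N) → ℝ)
    (ξ : ℝ → EuclideanSpace ℝ (Fin N) → EuclideanSpace ℝ (Fin N)) (t : ℝ)
    (x : EuclideanSpace ℝ (Fin N)) : EuclideanSpace ℝ (Fin N) :=
  ξ (φ x * t) x

variable {φ : EuclideanSpace ℝ (Fin N) → ℝ}
  {ξ : ℝ → EuclideanSpace ℝ (Fin N) → EuclideanSpace ℝ (Fin N)} {δ : ℝ}
  {S : Set (EuclideanSpace ℝ (Fin N))}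

theorem mul_mem_Ioo {a t δ : ℝ} (ha : a ∈ Icc (0 : ℝ) 1) (ht : t ∈ Ioo (-δ) δ) :
    a * t ∈ Ioo (-δ) δ := by
  rw [mem_Ioo, ← abs_lt] at ht ⊢
  rw [abs_mul, abs_of_nonneg ha.1]
  exact (mul_le_of_le_one_left (abs_nonneg t) ha.2).trans_lt ht

theorem cutoff_of_eq_one {x : EuclideanSpace ℝ (Fin N)} (hx : φ x = 1) (t : ℝ) :
    cutoff φ ξ t x = ξ t x := by
  rw [cutoff, hx, one_mul]

theorem cutoff_of_eq_zero (h : ∀ x, ξ 0 x = x) {x : EuclideanSpace ℝ (Fin N)} (hx : φ x = 0)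
    (t : ℝ) : cutoff φ ξ t x = x := by
  rw [cutoff, hx, zero_mul, h]

theorem velocity_cutoff_of_eq_one {x : EuclideanSpace ℝ (Fin N)} (hx : φ x = 1) :
    velocity (cutoff φ ξ) x = velocity ξ x := by
  simp only [velocity, cutoff_of_eq_one hx]

theorem velocity_cutoff_of_eq_zero (h : ∀ x, ξ 0 x = x) {x : EuclideanSpace ℝ (Fin N)}
    (hx : φ x = 0) : velocity (cutoff φ ξ) x = 0 := by
  simp only [velocity, cutoff_of_eq_zero h hx, deriv_const]

/-- Localization turns a variation of one hypersurface `S` into a variation of any family in which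
the other hypersurfaces avoid the support of the cutoff function. -/
theorem IsVariation.exists_cutoff {ι κ : Type} {T : κ → Set (EuclideanSpace ℝ (Fin N))}
    {M : ι → Set (EuclideanSpace ℝ (Fin N))} (h : IsVariation T ξ δ) (hST : S ⊆ ⋃ k, T k)
    (hS : IsCompact S)
    (hφ : ContDiff ℝ 2 φ) (hφ01 : ∀ x, φ x ∈ Icc (0 : ℝ) 1)
    (hφS : S ⊆ interior {x | φ x = 1})
    (hM : ∀ i, M i ⊆ S ∨ M i ⊆ interior {x | φ x = 0}) :
    ∃ δ' ≤ δ, IsVariation M (cutoff φ ξ) δ' := by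
  obtain ⟨K, hK, hKx⟩ := h.compact_support
  obtain ⟨V, hV, hMV, hflow⟩ := h.flow
  have hsmooth : ContDiffOn ℝ 2
      (fun q : ℝ × EuclideanSpace ℝ (Fin N) => cutoff φ ξ q.1 q.2) (Ioo (-δ) δ ×ˢ univ) := by
    have h1 : ContDiff ℝ 2 (fun q : ℝ × EuclideanSpace ℝ (Fin N) => (φ q.2 * q.1, q.2)) :=
      ((hφ.comp contDiff_snd).mul contDiff_fst).prodMk contDiff_snd
    exact h.contDiffOn.comp h1.contDiffOn
      (fun q hq => ⟨mul_mem_Ioo (hφ01 q.2) hq.1, mem_univ _⟩)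
  have hzero : ∀ x, cutoff φ ξ 0 x = x := fun x => by rw [cutoff, mul_zero, h.zero]
  have hsupp : ∀ t ∈ Ioo (-δ) δ, ∀ x, x ∉ K → cutoff φ ξ t x = x := fun t ht x hx =>
    hKx _ (mul_mem_Ioo (hφ01 x) ht) x hx
  -- trajectories starting near `S` stay where `φ = 1` for a short time
  obtain ⟨u, v, hu, hv, h0u, hSv, huv⟩ := generalized_tube_lemma (isCompact_singleton (x := (0 : ℝ)))
    hS (h.contDiffOn.continuousOn.isOpen_inter_preimage (isOpen_timeStrip δ)
      (isOpen_interior (s := {x | φ x = 1}))) (by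
        rintro ⟨t, x⟩ ⟨rfl, hx⟩
        refine ⟨⟨h.zero_mem, mem_univ _⟩, ?_⟩
        simpa only [mem_preimage, h.zero] using hφS hx)
  obtain ⟨ε, hε, hball⟩ := Metric.eventually_nhds_iff_ball.1
    ((eventually_fderiv_close h.pos hsmooth hzero hK hsupp).and
      (hu.mem_nhds (h0u (mem_singleton _))))
  rw [Real.ball_eq_Ioo, zero_sub, zero_add] at hball
  have hsub : Ioo (-min δ ε) (min δ ε) ⊆ Ioo (-δ) δ :=
    Ioo_subset_Ioo (neg_le_neg (min_le_left _ _)) (min_le_left _ _)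
  have hsub' : Ioo (-min δ ε) (min δ ε) ⊆ Ioo (-ε) ε :=
    Ioo_subset_Ioo (neg_le_neg (min_le_right _ _)) (min_le_right _ _)
  refine ⟨min δ ε, min_le_left _ _, lt_min h.pos hε,
    hsmooth.mono (prod_mono hsub Subset.rfl), fun t ht => ?_, hzero,
    ⟨K, hK, fun t ht => hsupp t (hsub ht)⟩,
    ⟨(V ∩ v ∩ interior {x | φ x = 1}) ∪ interior {x | φ x = 0},
      ((hV.inter hv).inter isOpen_interior).union isOpen_interior, ?_, ?_⟩⟩
  · have h1 : ContDiff ℝ 2 (fun x : EuclideanSpace ℝ (Fin N) => (t, x)) :=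
      contDiff_const.prodMk contDiff_id
    have h2 : ContDiff ℝ 2 (cutoff φ ξ t) := contDiffOn_univ.1 <|
      hsmooth.comp h1.contDiffOn (fun x _ => ⟨hsub ht, mem_univ x⟩)
    exact exists_contDiff_inverse_of_fderiv_close h2 (hball t (hsub' ht)).1
  · refine iUnion_subset fun i => ?_
    rcases hM i with hi | hi
    · exact fun x hx => Or.inl ⟨⟨hMV (hST (hi hx)), hSv (hi hx)⟩, hφS (hi hx)⟩
    · exact fun x hx => Or.inr (hi hx)
  · rintro t ht x (⟨⟨hxV, hxv⟩, hx1⟩ | hx0)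
    · have hx : φ x = 1 := interior_subset (s := {x | φ x = 1}) hx1
      have hy : φ (ξ t x) = 1 := interior_subset (s := {x | φ x = 1})
        (huv (mk_mem_prod (hball t (hsub' ht)).2 hxv)).2
      simpa only [cutoff_of_eq_one hx, velocity_cutoff_of_eq_one hy] using hflow t (hsub ht) x hxV
    · have hx : φ x = 0 := interior_subset (s := {x | φ x = 0}) hx0
      simpa only [cutoff_of_eq_zero h.zero hx, velocity_cutoff_of_eq_zero h.zero hx] using
        hasDerivAt_const t x

/-- Localization keeps an invariant set invariant. -/
theorem cutoff_image_eq {ι κ : Type} {T : κ → Set (EuclideanSpace ℝ (Fin N))}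
    {M : ι → Set (EuclideanSpace ℝ (Fin N))} {δ' : ℝ} (h : IsVariation T ξ δ)
    (h' : IsVariation M (cutoff φ ξ) δ') (hδ' : δ' ≤ δ) (hφ01 : ∀ x, φ x ∈ Icc (0 : ℝ) 1)
    {F : Set (EuclideanSpace ℝ (Fin N))} (hF : ∀ t ∈ Ioo (-δ) δ, ξ t '' F = F) {t : ℝ}
    (ht : t ∈ Ioo (-δ') δ') : cutoff φ ξ t '' F = F := by
  have hmem : ∀ x, φ x * t ∈ Ioo (-δ) δ := fun x =>
    mul_mem_Ioo (hφ01 x) (Ioo_subset_Ioo (neg_le_neg hδ') hδ' ht)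
  ext y
  constructor
  · rintro ⟨x, hx, rfl⟩
    rw [← hF _ (hmem x)]
    exact mem_image_of_mem _ hx
  · intro hy
    obtain ⟨x, rfl⟩ := h'.surjective ht y
    refine ⟨x, ?_, rfl⟩
    rw [← hF _ (hmem x)] at hy
    obtain ⟨z, hz, hzx⟩ := hy
    exact h.injective (hmem x) hzx ▸ hz

theorem exists_contDiff_cutoff {E : Type*} [NormedAddCommGroup E] [NormedSpace ℝ E]
    [FiniteDimensional ℝ E] {S W : Set E} (hS : IsClosed S) (hW : IsOpen W) (hSW : S ⊆ W) :
    ∃ φ : E → ℝ, ContDiff ℝ 2 φ ∧ (∀ x, φ x ∈ Icc (0 : ℝ) 1) ∧ S ⊆ interior {x | φ x = 1} ∧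
      Wᶜ ⊆ interior {x | φ x = 0} := by
  obtain ⟨φ, h0, h1, h01⟩ := exists_contMDiffMap_zero_one_nhds_of_isClosed (n := 2)
    (modelWithCornersSelf ℝ E) hW.isClosed_compl hS
    (Set.disjoint_left.2 fun x hx hxS => hx (hSW hxS))
  exact ⟨φ, φ.contMDiff.contDiff, h01, subset_interior_iff_mem_nhdsSet.2 h1,
    subset_interior_iff_mem_nhdsSet.2 h0⟩

end Cutoff

/-! ### The phases of a single interface -/

section Phases

variable {N : ℕ}

theorem SeparatesAt.eventually_cover {Ω S A B : Set (EuclideanSpace ℝ (Fin N))}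
    {p : EuclideanSpace ℝ (Fin N)} (h : SeparatesAt Ω S A B p) :
    ∀ᶠ x in 𝓝 p, x ∈ Ω → x ∈ S ∨ x ∈ A ∨ x ∈ B := by
  obtain ⟨ρ, -, -, hS, hA, hB, -⟩ := h
  filter_upwards [hS, hA, hB] with x hxS hxA hxB hx
  rcases lt_trichotomy (ρ x) 0 with h | h | h
  · exact Or.inr (Or.inl (hxA.2 ⟨hx, h⟩))
  · exact Or.inl (hxS.2 ⟨subset_closure hx, h⟩)
  · exact Or.inr (Or.inr (hxB.2 ⟨hx, h⟩))

theorem SeparatesAt.enlarge {Ω S A B A' B' : Set (EuclideanSpace ℝ (Fin N))}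
    {p : EuclideanSpace ℝ (Fin N)} (h : SeparatesAt Ω S A B p) (hA : A ⊆ A') (hB : B ⊆ B')
    (hA' : A' ⊆ Ω \ S) (hB' : B' ⊆ Ω \ S) (hdisj : Disjoint A' B') :
    SeparatesAt Ω S A' B' p := by
  have hcover := h.eventually_cover
  obtain ⟨ρ, hρ, hne, hS, hxA, hxB, hfr⟩ := h
  refine ⟨ρ, hρ, hne, hS, ?_, ?_, hfr⟩
  · filter_upwards [hcover, hxA] with x hx hxA
    refine ⟨fun hx' => hxA.1 ?_, fun hx' => hA (hxA.2 hx')⟩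
    rcases hx (hA' hx').1 with h | h | h
    · exact absurd h (hA' hx').2
    · exact h
    · exact absurd (hB h) (Set.disjoint_left.1 hdisj hx')
  · filter_upwards [hcover, hxB] with x hx hxB
    refine ⟨fun hx' => hxB.1 ?_, fun hx' => hB (hxB.2 hx')⟩
    rcases hx (hB' hx').1 with h | h | h
    · exact absurd h (hB' hx').2
    · exact absurd hx' (Set.disjoint_left.1 hdisj (hA h))
    · exact h

theorem phases_eq_components {ι : Type} (Ω : Set (EuclideanSpace ℝ (Fin N)))
    (M : ι → Set (EuclideanSpace ℝ (Fin N))) : phases Ω M = components (Ω \ ⋃ i, M i) :=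
  rfl

theorem phases_single (Ω S : Set (EuclideanSpace ℝ (Fin N))) :
    phases Ω (fun _ : Unit => S) = components (Ω \ S) := by
  rw [phases_eq_components, iUnion_const]

theorem IsConnectedPartitioning.volume_eq_zero {ι : Type} {Ω : Set (EuclideanSpace ℝ (Fin N))}
    {M : ι → Set (EuclideanSpace ℝ (Fin N))} {m : ℕ} (hM : IsConnectedPartitioning Ω M m)
    (i : ι) : volume (M i) = 0 := by
  obtain ⟨A, -, B, -, hsep⟩ := hM.separates i
  exact volume_eq_zero_of_separatesAt (hM.isCompact i) hsep

variable {m : ℕ} {Ω : Set (EuclideanSpace ℝ (Fin N))}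
  {M : Fin (m - 1) → Set (EuclideanSpace ℝ (Fin N))}

theorem IsConnectedPartitioning.exists_phases_single (hM : IsConnectedPartitioning Ω M m)
    (hΩ : IsOpen Ω) (hΩc : IsConnected Ω) (i : Fin (m - 1)) :
    ∃ A ∈ phases Ω M, ∃ B ∈ phases Ω M, ∃ UA UB, components (Ω \ M i) = {UA, UB} ∧ UA ≠ UB ∧
      A ⊆ UA ∧ B ⊆ UB ∧ ∀ p ∈ M i, SeparatesAt Ω (M i) A B p := by
  choose A hA B hB hsep using hM.separates
  obtain ⟨UA, UB, hpair, hne, hAU, hBU⟩ := exists_components_diff_eq_pair hΩ hΩc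
    (fun j => (hM.isCompact j).isClosed) hA hB (fun j p hp => (hsep j p hp).eventually_cover)
    hM.card_phases i
  exact ⟨A i, hA i, B i, hB i, UA, UB, hpair, hne, hAU, hBU, hsep i⟩

theorem IsConnectedPartitioning.single (hM : IsConnectedPartitioning Ω M m)
    (hΩ : IsOpen Ω) (hΩc : IsConnected Ω) (i : Fin (m - 1)) :
    IsConnectedPartitioning Ω (fun _ : Unit => M i) 2 := by
  obtain ⟨A, hA, B, hB, UA, UB, hpair, hne, hAU, hBU, hsep⟩ :=
    hM.exists_phases_single hΩ hΩc i
  have hUA : UA ∈ components (Ω \ M i) := hpair ▸ mem_insert UA {UB}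
  have hUB : UB ∈ components (Ω \ M i) := hpair ▸ mem_insert_of_mem UA rfl
  refine ⟨fun _ => hM.nonempty i, fun _ => hM.isCompact i, fun _ => hM.subset_closure i,
    fun j k hjk => absurd (Subsingleton.elim j k) hjk, ?_, fun _ => ?_⟩
  · rw [phases_single, hpair, Set.encard_pair hne]
    rfl
  · rw [phases_single]
    exact ⟨UA, hUA, UB, hUB, fun p hp => (hsep p hp).enlarge hAU hBU
      (subset_of_mem_components hUA) (subset_of_mem_components hUB)
      (disjoint_of_mem_components hUA hUB hne)⟩

end Phases

/-! ### Admissible variations of a partitioning and of its interfaces -/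

section Admissible

variable {N : ℕ}

/-- Up to a null set, a component of the complement of one interface is the union of the phases
that it contains. -/
theorem IsVariation.volume_image_component {ι : Type} {Ω : Set (EuclideanSpace ℝ (Fin N))}
    {M : ι → Set (EuclideanSpace ℝ (Fin N))} [Countable ι]
    {ξ : ℝ → EuclideanSpace ℝ (Fin N) → EuclideanSpace ℝ (Fin N)} {δ : ℝ}
    (h : IsVariation M ξ δ) (hopen : IsOpen (Ω \ ⋃ i, M i)) (hnull : ∀ i, volume (M i) = 0)
    (hfin : (phases Ω M).Finite) {i : ι} {U : Set (EuclideanSpace ℝ (Fin N))}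
    (hU : U ∈ components (Ω \ M i)) {t : ℝ} (ht : t ∈ Ioo (-δ) δ) :
    volume (ξ t '' U) = ∑' C : {C // C ∈ phases Ω M ∧ C ⊆ U}, volume (ξ t '' C.1) := by
  have hcount : {C | C ∈ phases Ω M ∧ C ⊆ U}.Countable :=
    (hfin.subset fun C hC => hC.1).countable
  have hsub : U ⊆ (⋃ C ∈ {C | C ∈ phases Ω M ∧ C ⊆ U}, C) ∪ ⋃ j, M j := by
    intro x hx
    by_cases hxM : x ∈ ⋃ j, M j
    · exact Or.inr hxM
    · have hxΩ : x ∈ Ω \ ⋃ j, M j := ⟨(subset_of_mem_components hU hx).1, hxM⟩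
      refine Or.inl (mem_biUnion (x := connectedComponentIn (Ω \ ⋃ j, M j) x)
        ⟨connectedComponentIn_mem_components hxΩ, ?_⟩ (mem_connectedComponentIn hxΩ))
      exact subset_of_mem_components_of_inter_nonempty hU isPreconnected_connectedComponentIn
        ((connectedComponentIn_subset _ _).trans
          (sdiff_subset_sdiff_right (subset_iUnion M i)))
        ⟨x, mem_connectedComponentIn hxΩ, hx⟩
  have hnull' : volume (ξ t '' ⋃ j, M j) = 0 :=
    h.volume_image_eq_zero ht (measure_iUnion_null hnull)
  have heq : volume (ξ t '' U) =
      volume (ξ t '' ⋃ C ∈ {C | C ∈ phases Ω M ∧ C ⊆ U}, C) := by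
    refine le_antisymm ?_ (measure_mono (image_mono (iUnion₂_subset fun C hC => hC.2)))
    calc volume (ξ t '' U) ≤ volume (ξ t '' (⋃ C ∈ {C | C ∈ phases Ω M ∧ C ⊆ U}, C) ∪
          ξ t '' ⋃ j, M j) := by
          rw [← image_union]
          exact measure_mono (image_mono hsub)
      _ ≤ _ := (measure_union_le _ _).trans (by rw [hnull', add_zero])
  obtain ⟨e, he⟩ := h.exists_homeomorph ht
  rw [heq, image_iUnion₂, measure_biUnion hcount]
  · rfl
  · intro C hC D hD hCD
    exact (disjoint_image_iff (h.injective ht)).2 (disjoint_of_mem_components hC.1 hD.1 hCD)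
  · intro C hC
    rw [← he]
    exact (e.isOpenMap C (isOpen_of_mem_components hopen hC.1)).measurableSet

/-- An admissible variation of a partitioning is admissible for each of its interfaces. -/
theorem IsAdmissible.single {ι : Type} [Finite ι] {Ω : Set (EuclideanSpace ℝ (Fin N))}
    {M : ι → Set (EuclideanSpace ℝ (Fin N))} {m : ℕ}
    {ξ : ℝ → EuclideanSpace ℝ (Fin N) → EuclideanSpace ℝ (Fin N)}
    (hM : IsConnectedPartitioning Ω M m) (hΩ : IsOpen Ω) (h : IsAdmissible Ω M ξ) (i : ι) :
    IsAdmissible Ω (fun _ : Unit => M i) ξ := by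
  obtain ⟨δ, hvar, hfr, hvol⟩ := h
  refine ⟨δ, hvar.single i, hfr, fun t ht U hU => ?_⟩
  rw [phases_single] at hU
  have hopen : IsOpen (Ω \ ⋃ i, M i) :=
    hΩ.sdiff (isClosed_iUnion_of_finite fun j => (hM.isCompact j).isClosed)
  have hfin : (phases Ω M).Finite := by
    rw [← Set.encard_ne_top_iff, hM.card_phases]
    exact ENat.natCast_ne_top m
  have hid : ∀ D : Set (EuclideanSpace ℝ (Fin N)), ξ 0 '' D = D := fun D => by
    rw [show ξ 0 = id from funext hvar.zero, image_id]
  have h0 := hvar.volume_image_component hopen hM.volume_eq_zero hfin hU hvar.zero_mem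
  rw [hid] at h0
  rw [hvar.volume_image_component hopen hM.volume_eq_zero hfin hU ht, h0]
  exact tsum_congr fun C => by rw [hvol t ht C.1 C.2.1, hid]

/-- If a homeomorphism supported in `W` preserves the volume of `U`, it preserves the volume of
every set that agrees with `U` in `W`. -/
theorem volume_image_eq_of_inter_eq {α : Type*} [TopologicalSpace α] [MeasurableSpace α]
    [BorelSpace α] {μ : Measure α} (e : α ≃ₜ α) {W C U : Set α} (hW : IsOpen W)
    (he : ∀ x ∉ W, e x = x) (hCU : C ∩ W = U ∩ W) (hU : μ U ≠ ⊤) (h : μ (e '' U) = μ U) :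
    μ (e '' C) = μ C := by
  have heW : ∀ x, e x ∈ W ↔ x ∈ W := by
    intro x
    refine ⟨fun hx => ?_, fun hx => ?_⟩
    · by_contra hn
      exact hn (he x hn ▸ hx)
    · by_contra hn
      exact hn (by rwa [e.injective (he _ hn)])
  have hsplit : ∀ D : Set α, μ (e '' D) = μ (e '' (D ∩ W)) + μ (D \ W) := by
    intro D
    rw [← measure_inter_add_sdiff (e '' D) hW.measurableSet]
    congr 2
    · ext y
      constructor
      · rintro ⟨⟨x, hx, rfl⟩, hy⟩
        exact ⟨x, ⟨hx, (heW x).1 hy⟩, rfl⟩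
      · rintro ⟨x, ⟨hx, hxW⟩, rfl⟩
        exact ⟨⟨x, hx, rfl⟩, (heW x).2 hxW⟩
    · ext y
      constructor
      · rintro ⟨⟨x, hx, rfl⟩, hy⟩
        have hxW : x ∉ W := fun hxW => hy ((heW x).2 hxW)
        rw [he x hxW]
        exact ⟨hx, hxW⟩
      · rintro ⟨hy, hyW⟩
        exact ⟨⟨y, hy, he y hyW⟩, hyW⟩
  have hUW : μ (e '' (U ∩ W)) = μ (U ∩ W) := by
    rw [hsplit U, ← measure_inter_add_sdiff U hW.measurableSet] at h
    exact (ENNReal.add_left_inj (measure_ne_top_of_subset sdiff_subset hU)).1 h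
  rw [hsplit C, hCU, hUW, ← hCU, measure_inter_add_sdiff C hW.measurableSet]

/-- An admissible variation of one interface can be localized to an admissible variation of the
whole partitioning which does not move the other interfaces. -/
theorem IsAdmissible.exists_localization {m : ℕ} {Ω : Set (EuclideanSpace ℝ (Fin N))}
    {M : Fin (m - 1) → Set (EuclideanSpace ℝ (Fin N))}
    {ξ : ℝ → EuclideanSpace ℝ (Fin N) → EuclideanSpace ℝ (Fin N)}
    (hM : IsConnectedPartitioning Ω M m) (hΩ : IsOpen Ω) (hΩb : Bornology.IsBounded Ω)
    (hΩc : IsConnected Ω) {i : Fin (m - 1)} (h : IsAdmissible Ω (fun _ : Unit => M i) ξ) :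
    ∃ ζ, IsAdmissible Ω M ζ ∧
      (∀ x ∈ M i, velocity ζ x = velocity ξ x ∧ ∀ t, ζ t x = ξ t x) ∧
      ∀ j ≠ i, ∀ x ∈ M j, velocity ζ x = 0 ∧ ∀ t, ζ t x = x := by
  obtain ⟨δ, hvar, hfr, hvol⟩ := h
  obtain ⟨A, hA, B, hB, UA, UB, hpair, hne, hAU, hBU, hsep⟩ :=
    hM.exists_phases_single hΩ hΩc i
  have hUA : UA ∈ components (Ω \ M i) := hpair ▸ mem_insert UA {UB}
  have hUB : UB ∈ components (Ω \ M i) := hpair ▸ mem_insert_of_mem UA rfl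
  have hdisj := disjoint_of_mem_components hUA hUB hne
  have hclosed : ∀ j, IsClosed (M j) := fun j => (hM.isCompact j).isClosed
  -- a neighbourhood of `M i` that avoids the other interfaces and the phases not adjacent to `M i`
  set W : Set (EuclideanSpace ℝ (Fin N)) :=
    interior {x | x ∈ Ω → x ∈ M i ∨ x ∈ A ∨ x ∈ B} ∩ (⋃ j ∈ {j | j ≠ i}, M j)ᶜ
  have hW : IsOpen W := isOpen_interior.inter
    ((Set.toFinite {j | j ≠ i}).isClosed_biUnion fun j _ => hclosed j).isOpen_compl
  have hMW : M i ⊆ W := by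
    intro x hx
    refine ⟨mem_interior_iff_mem_nhds.2 (hsep x hx).eventually_cover, ?_⟩
    simp only [mem_compl_iff, mem_iUnion, not_exists]
    exact fun j hj hxj => Set.disjoint_left.1 (hM.disjoint hj) hxj hx
  have hWcover : ∀ x ∈ W, x ∈ Ω → x ∈ M i ∨ x ∈ A ∨ x ∈ B := fun x hx =>
    interior_subset (s := {x | x ∈ Ω → x ∈ M i ∨ x ∈ A ∨ x ∈ B}) hx.1
  have hMjW : ∀ j ≠ i, M j ⊆ Wᶜ := fun j hj x hx hxW => hxW.2 (mem_biUnion hj hx)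
  obtain ⟨φ, hφ, hφ01, hφ1, hφ0⟩ := exists_contDiff_cutoff (hclosed i) hW hMW
  have h1 : ∀ x ∈ M i, φ x = 1 := fun x hx => interior_subset (s := {x | φ x = 1}) (hφ1 hx)
  have h0 : ∀ x ∉ W, φ x = 0 := fun x hx => interior_subset (s := {x | φ x = 0}) (hφ0 hx)
  obtain ⟨δ', hδ', hcut⟩ := hvar.exists_cutoff (M := M) (subset_iUnion (fun _ : Unit => M i) ())
    (hM.isCompact i) hφ hφ01 hφ1 (fun j => by
      by_cases hj : j = i
      · exact Or.inl (hj ▸ Subset.rfl)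
      · exact Or.inr ((hMjW j hj).trans hφ0))
  refine ⟨cutoff φ ξ, ⟨δ', hcut, fun t ht => cutoff_image_eq hvar hcut hδ' hφ01 hfr ht, ?_⟩,
    fun x hx => ⟨velocity_cutoff_of_eq_one (h1 x hx), cutoff_of_eq_one (h1 x hx)⟩,
    fun j hj x hx => ⟨velocity_cutoff_of_eq_zero hvar.zero (h0 x (hMjW j hj hx)),
      cutoff_of_eq_zero hvar.zero (h0 x (hMjW j hj hx))⟩⟩
  intro t ht C hC
  have htδ : t ∈ Ioo (-δ) δ := Ioo_subset_Ioo (neg_le_neg hδ') hδ' ht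
  obtain ⟨e, he⟩ := hcut.exists_homeomorph ht
  obtain ⟨k, hk⟩ := hvar.exists_homeomorph htδ
  have hoff : ∀ x ∉ W, e x = x := fun x hx => by
    rw [he, cutoff_of_eq_zero hvar.zero (h0 x hx)]
  -- the localized variation moves the two components of `Ω \ M i` in the same way as `ξ`
  have hvolU : ∀ U ∈ components (Ω \ M i), volume (e '' U) = volume U := by
    intro U hU
    have hUΩ : U ≠ Ω := by
      rintro rfl
      have hall : ∀ D ∈ components (U \ M i), D = U := fun D hD => by
        obtain ⟨x, hx⟩ := nonempty_of_mem_components hD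
        exact eq_of_mem_components hD hU hx (subset_of_mem_components hD hx).1
      exact hne ((hall UA hUA).trans (hall UB hUB).symm)
    have himg : e '' U = k '' U := by
      refine image_component_eq_of_eqOn hΩ hΩc (hclosed i) hU hUΩ
        (isOpen_interior (s := {x | φ x = 1})) hφ1 e k ?_ ?_ ?_
      · rw [he]
        exact hcut.image_eq_of_frontier hΩ
          (fun s hs => cutoff_image_eq hvar hcut hδ' hφ01 hfr hs) ht
      · rw [hk]
        exact hvar.image_eq_of_frontier hΩ hfr htδ
      · intro x hx
        rw [he, hk, cutoff_of_eq_one (interior_subset (s := {x | φ x = 1}) hx)]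
    rw [himg, hk]
    exact hvol t htδ U (by rwa [phases_single])
  have hfinite : ∀ U ∈ components (Ω \ M i), volume U ≠ ⊤ := fun U hU =>
    measure_ne_top_of_subset ((subset_of_mem_components hU).trans sdiff_subset)
      hΩb.measure_lt_top.ne
  have hCsub : C ⊆ Ω \ M i := (subset_of_mem_components hC).trans
    (sdiff_subset_sdiff_right (subset_iUnion M i))
  rw [← he]
  by_cases hCA : C = A
  · refine volume_image_eq_of_inter_eq e hW hoff (U := UA) ?_ (hfinite UA hUA) (hvolU UA hUA)
    subst hCA
    refine Subset.antisymm (inter_subset_inter_left W hAU) ?_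
    rintro x ⟨hx, hxW⟩
    obtain ⟨hxΩ, hxM⟩ := subset_of_mem_components hUA hx
    rcases hWcover x hxW hxΩ with h | h | h
    · exact absurd h hxM
    · exact ⟨h, hxW⟩
    · exact absurd (hBU h) (Set.disjoint_left.1 hdisj hx)
  by_cases hCB : C = B
  · refine volume_image_eq_of_inter_eq e hW hoff (U := UB) ?_ (hfinite UB hUB) (hvolU UB hUB)
    subst hCB
    refine Subset.antisymm (inter_subset_inter_left W hBU) ?_
    rintro x ⟨hx, hxW⟩
    obtain ⟨hxΩ, hxM⟩ := subset_of_mem_components hUB hx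
    rcases hWcover x hxW hxΩ with h | h | h
    · exact absurd h hxM
    · exact absurd hx (Set.disjoint_left.1 hdisj (hAU h))
    · exact ⟨h, hxW⟩
  · have hid : EqOn e id C := by
      intro x hx
      refine hoff x fun hxW => ?_
      rcases hWcover x hxW (hCsub hx).1 with h | h | h
      · exact (hCsub hx).2 h
      · exact hCA (eq_of_mem_components hC hA hx h)
      · exact hCB (eq_of_mem_components hC hB hx h)
    rw [hid.image_eq, image_id]

end Admissible

/-! ### Area of variations -/

section Area

variable {N : ℕ} {ι : Type} [Fintype ι] {γ : ι → ℝ}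
  {M : ι → Set (EuclideanSpace ℝ (Fin N))}
  {ξ : ℝ → EuclideanSpace ℝ (Fin N) → EuclideanSpace ℝ (Fin N)}

theorem totalArea_single (S : Set (EuclideanSpace ℝ (Fin N))) :
    totalArea (fun _ : Unit => (1 : ℝ)) (fun _ => S) = area S := by
  simp [totalArea]

theorem hasSecondVariation_single_iff {S : Set (EuclideanSpace ℝ (Fin N))} {c : ℝ} :
    HasSecondVariation (fun _ : Unit => (1 : ℝ)) (fun _ => S) ξ c ↔
      HasSecondDerivAtZero (fun t => area (ξ t '' S)) c := by
  simp only [HasSecondVariation, totalArea_single]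
  exact ⟨fun h => h.2, fun h => ⟨fun _ => ⟨c, h⟩, h⟩⟩

theorem hasSecondVariation_of_forall {b : ι → ℝ}
    (h : ∀ i, HasSecondDerivAtZero (fun t => area (ξ t '' M i)) (b i)) :
    HasSecondVariation γ M ξ (∑ i, γ i * b i) :=
  ⟨fun i => ⟨b i, h i⟩, HasSecondDerivAtZero.sum fun i => (h i).const_mul (γ i)⟩

/-- If only the interface `M i` moves, the weighted area is that of `M i` up to a constant. -/
theorem totalArea_eq_of_localized [DecidableEq ι] {i : ι}
    (hfix : ∀ j ≠ i, ∀ x ∈ M j, ∀ t, ξ t x = x) (t : ℝ) :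
    totalArea γ (fun j => ξ t '' M j) =
      γ i * area (ξ t '' M i) + ∑ j ∈ Finset.univ.erase i, γ j * area (M j) := by
  rw [totalArea, ← Finset.add_sum_erase _ _ (Finset.mem_univ i)]
  congr 1
  refine Finset.sum_congr rfl fun j hj => ?_
  have : EqOn (ξ t) id (M j) := fun x hx => hfix j (Finset.ne_of_mem_erase hj) x hx t
  rw [this.image_eq, image_id]

end Area

section Transfer

variable {N m : ℕ} {Ω : Set (EuclideanSpace ℝ (Fin N))}
  {M : Fin (m - 1) → Set (EuclideanSpace ℝ (Fin N))} {γ : Fin (m - 1) → ℝ}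

theorem IsMinimal.single (hmin : IsMinimal Ω γ M) (hM : IsConnectedPartitioning Ω M m)
    (hΩ : IsOpen Ω) (hΩb : Bornology.IsBounded Ω) (hΩc : IsConnected Ω) (hγ : ∀ i, 0 < γ i)
    (i : Fin (m - 1)) : IsMinimal Ω (fun _ : Unit => (1 : ℝ)) (fun _ : Unit => M i) := by
  intro ξ hξ
  obtain ⟨ζ, hζ, hζi, hζj⟩ := hξ.exists_localization hM hΩ hΩb hΩc
  have h := hmin ζ hζ
  have himg : ∀ t, ζ t '' M i = ξ t '' M i := fun t => image_congr fun x hx => (hζi x hx).2 t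
  simp only [totalArea_eq_of_localized (fun j hj x hx => (hζj j hj x hx).2), himg] at h
  have h' := ((hasDerivAt_add_const_iff _).1 h).const_mul (γ i)⁻¹
  simp only [inv_mul_cancel_left₀ (hγ i).ne', mul_zero] at h'
  simpa only [totalArea_single] using h'

theorem IsNormal.single {ξ : ℝ → EuclideanSpace ℝ (Fin N) → EuclideanSpace ℝ (Fin N)}
    (h : IsNormal M ξ) (i : Fin (m - 1)) : IsNormal (fun _ : Unit => M i) ξ :=
  fun _ => h i

/-- For every admissible normal variation of one interface there is one of the whole partitioning
that has the same effect on this interface and leaves the others fixed. -/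
theorem IsAdmissible.exists_normal_localization
    {ξ : ℝ → EuclideanSpace ℝ (Fin N) → EuclideanSpace ℝ (Fin N)}
    (hM : IsConnectedPartitioning Ω M m) (hΩ : IsOpen Ω) (hΩb : Bornology.IsBounded Ω)
    (hΩc : IsConnected Ω) {i : Fin (m - 1)} (h : IsAdmissible Ω (fun _ : Unit => M i) ξ)
    (hn : IsNormal (fun _ : Unit => M i) ξ) :
    ∃ ζ, IsAdmissible Ω M ζ ∧ IsNormal M ζ ∧ (∀ x ∈ M i, velocity ζ x = velocity ξ x) ∧
      (∀ t, ζ t '' M i = ξ t '' M i) ∧ ∀ j ≠ i, ∀ t, ζ t '' M j = M j := by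
  obtain ⟨ζ, hζ, hζi, hζj⟩ := h.exists_localization hM hΩ hΩb hΩc
  refine ⟨ζ, hζ, fun j p hp => ?_, fun x hx => (hζi x hx).1,
    fun t => image_congr fun x hx => (hζi x hx).2 t, fun j hj t => ?_⟩
  · by_cases hj : j = i
    · subst hj
      rw [(hζi p hp).1]
      exact hn () p hp
    · rw [(hζj j hj p hp).1]
      exact Submodule.zero_mem _
  · have : EqOn (ζ t) id (M j) := fun x hx => (hζj j hj x hx).2 t
    rw [this.image_eq, image_id]

/-- The second variation of a localized variation is the weighted second variation of the interface
that moves. -/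
theorem hasSecondVariation_localized {i : Fin (m - 1)}
    {ξ ζ : ℝ → EuclideanSpace ℝ (Fin N) → EuclideanSpace ℝ (Fin N)} {b : ℝ}
    (hi : ∀ t, ζ t '' M i = ξ t '' M i) (hj : ∀ j ≠ i, ∀ t, ζ t '' M j = M j)
    (hb : HasSecondDerivAtZero (fun t => area (ξ t '' M i)) b) :
    HasSecondVariation γ M ζ (γ i * b) := by
  have h := hasSecondVariation_of_forall (γ := γ) (M := M) (ξ := ζ)
    (b := fun j => if j = i then b else 0) (fun j => by
      by_cases hji : j = i
      · subst hji
        simpa only [hi, if_true] using hb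
      · simpa only [hj j hji, if_neg hji] using hasSecondDerivAtZero_const (area (M j)))
  simpa using h

theorem isStable_iff_forall_single (hM : IsConnectedPartitioning Ω M m)
    (hΩ : IsOpen Ω) (hΩb : Bornology.IsBounded Ω) (hΩc : IsConnected Ω) (hγ : ∀ i, 0 < γ i)
    (hmin : IsMinimal Ω γ M) :
    IsStable Ω γ M ↔ ∀ i, IsStable Ω (fun _ : Unit => (1 : ℝ)) (fun _ : Unit => M i) := by
  constructor
  · rintro ⟨-, hst⟩ i
    refine ⟨hmin.single hM hΩ hΩb hΩc hγ i, fun ξ hξ hn ⟨_, p, hp, hvp⟩ => ?_⟩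
    obtain ⟨ζ, hζ, hζn, hv, hi, hj⟩ := hξ.exists_normal_localization hM hΩ hΩb hΩc hn
    obtain ⟨c, hc, hcv⟩ := hst ζ hζ hζn ⟨i, p, hp, by rwa [hv p hp]⟩
    obtain ⟨b, hb⟩ := hcv.1 i
    simp only [hi] at hb
    have hcb : c = γ i * b := hcv.2.unique (hasSecondVariation_localized hi hj hb).2
    exact ⟨b, pos_of_mul_pos_right (hcb ▸ hc) (hγ i).le, hasSecondVariation_single_iff.2 hb⟩
  · refine fun hst => ⟨hmin, fun ξ hξ hn ⟨i₀, p, hp, hvp⟩ => ?_⟩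
    -- an interface on which the velocity vanishes is left fixed
    have key : ∀ i, ∃ b, HasSecondDerivAtZero (fun t => area (ξ t '' M i)) b ∧ 0 ≤ b ∧
        ((∃ x ∈ M i, velocity ξ x ≠ 0) → 0 < b) := by
      intro i
      by_cases hx : ∃ x ∈ M i, velocity ξ x ≠ 0
      · obtain ⟨b, hb, hbv⟩ := (hst i).2 ξ (hξ.single hM hΩ i) (hn.single i) ⟨(), hx⟩
        exact ⟨b, hasSecondVariation_single_iff.1 hbv, hb.le, fun _ => hb⟩
      · refine ⟨0, ?_, le_rfl, fun h => absurd h hx⟩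
        push Not at hx
        obtain ⟨δ, hvar, -⟩ := hξ
        refine (hasSecondDerivAtZero_const (area (M i))).congr ?_
        filter_upwards [hvar.eventually_mem] with t ht
        rw [hvar.image_eq_of_velocity_eq_zero hx ht]
    choose b hb hb0 hbpos using key
    refine ⟨∑ i, γ i * b i, ?_, hasSecondVariation_of_forall hb⟩
    exact Finset.sum_pos' (fun i _ => mul_nonneg (hγ i).le (hb0 i))
      ⟨i₀, Finset.mem_univ _, mul_pos (hγ i₀) (hbpos i₀ ⟨p, hp, hvp⟩)⟩

theorem isUnstable_iff_exists_single (hM : IsConnectedPartitioning Ω M m)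
    (hΩ : IsOpen Ω) (hΩb : Bornology.IsBounded Ω) (hΩc : IsConnected Ω) (hγ : ∀ i, 0 < γ i)
    (hmin : IsMinimal Ω γ M) :
    IsUnstable Ω γ M ↔ ∃ i, IsUnstable Ω (fun _ : Unit => (1 : ℝ)) (fun _ : Unit => M i) := by
  constructor
  · rintro ⟨-, ξ, hξ, hn, c, hc, hcv⟩
    choose b hb using hcv.1
    have hcb : c = ∑ i, γ i * b i := hcv.2.unique (hasSecondVariation_of_forall hb).2
    obtain ⟨i, -, hi⟩ : ∃ i ∈ Finset.univ, γ i * b i < 0 := by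
      by_contra hcon
      push Not at hcon
      exact absurd (Finset.sum_nonneg hcon) (by rw [← hcb]; exact not_le.2 hc)
    exact ⟨i, hmin.single hM hΩ hΩb hΩc hγ i, ξ, hξ.single hM hΩ i, hn.single i, b i,
      (pos_iff_neg_of_mul_neg hi).1 (hγ i), hasSecondVariation_single_iff.2 (hb i)⟩
  · rintro ⟨i, -, ξ, hξ, hn, b, hb, hbv⟩
    obtain ⟨ζ, hζ, hζn, -, hi, hj⟩ := hξ.exists_normal_localization hM hΩ hΩb hΩc hn
    exact ⟨hmin, ζ, hζ, hζn, γ i * b, mul_neg_of_pos_of_neg (hγ i) hb,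
      hasSecondVariation_localized hi hj (hasSecondVariation_single_iff.1 hbv)⟩

end Transfer

end PhasePartition

end

open PhasePartition in
theorem mainTheorem5 {N m : ℕ} (Ω : Set (EuclideanSpace ℝ (Fin N)))
    (hΩ_open : IsOpen Ω) (hΩ_bounded : Bornology.IsBounded Ω) (hΩ_connected : IsConnected Ω)
    (hΩ_boundary : HasC2Boundary Ω)
    (M : Fin (m - 1) → Set (EuclideanSpace ℝ (Fin N)))
    (γ : Fin (m - 1) → ℝ) (hγ : ∀ i, 0 < γ i)
    (hM : IsConnectedPartitioning Ω M m) (hM_minimal : IsMinimal Ω γ M) :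
    (∀ i, IsConnectedPartitioning Ω (fun _ : Unit => M i) 2 ∧
      IsMinimal Ω (fun _ : Unit => 1) (fun _ : Unit => M i)) ∧
    (IsStable Ω γ M ↔ ∀ i, IsStable Ω (fun _ : Unit => 1) (fun _ : Unit => M i)) ∧
    (IsUnstable Ω γ M ↔ ∃ i, IsUnstable Ω (fun _ : Unit => 1) (fun _ : Unit => M i)) :=
  ⟨fun i => ⟨hM.single hΩ_open hΩ_connected i,
      hM_minimal.single hM hΩ_open hΩ_bounded hΩ_connected hγ i⟩,
    isStable_iff_forall_single hM hΩ_open hΩ_bounded hΩ_connected hγ hM_minimal,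
    isUnstable_iff_exists_single hM hΩ_open hΩ_bounded hΩ_connected hγ hM_minimal⟩
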